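/- **Setting.** For $\lambda=(\lambda_k)_{k\ge1}\in(0,1)^{\mathbb N}$ let $C^0_\lambda=[0,1]$ and, for $k\ge 0$, let $C^{k+1}_\lambda$ be obtained from $C^k_\lambda$, a union of $2^k$ disjoint closed intervals of equal length, by removing from each of these intervals $J$ the open central subinterval of length $(1-\lambda_{k+1})|J|$. The central Cantor set with ratios $\lambda$ is $\mathscr C_\lambda=\bigcap_{k\ge 0}C^k_\lambda$; when the $\lambda_k$ are i.i.d. random variables with values in $(0,1)$, it is called a random central Cantor set. Fix a universal machine $U$, i.e. a partial computable map from binary programs $\mathtt P\in\{0,1\}^*$ to finite sets $\mathtt C(\mathtt P)$ of rational numbers, given as finite lists of fractions, which simulates every other such machine $V$ with programs that are longer by at most an additive constant depending only on $V$. For a compact nonempty set $\mathscr C\subset\mathbb R$ and $\varepsilon>0$, the $\varepsilon$-distortion complexity is $$\Delta(\mathscr C,\varepsilon)=\min\{\ell(\mathtt P) : d_{\mathrm H}(\mathtt C(\mathtt P),\mathscr C)<\varepsilon\},$$ where $\ell(\mathtt P)$ is the length of $\mathtt P$ and $d_{\mathrm H}$ is the Hausdorff distance (infinite when $\mathtt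 C(\mathtt P)$ is empty), and programs on which $U$ does not halt are disregarded. Write $f\preccurlyeq g$ if there is a constant $C>0$ such that $f(\varepsilon)\le C\,g(\varepsilon)$ for all sufficiently small $\varepsilon>0$. **Theorem.** For every $\lambda\in(0,1)^{\mathbb N}$, $$\Delta(\mathscr C_\lambda,\varepsilon)\preccurlyeq\big(\log(\varepsilon^{-1})\big)^2 .$$ Moreover, let $(\lambda_k)_{k\ge1}$ be i.i.d. random variables with values in $(0,1)$ whose common distribution is absolutely continuous with respect to Lebesgue measure, with a density $f$ on $(0,1)$ satisfying $a\le f\le b$ for some constants $0<a\le b<\infty$. Then, for every $\delta>0$, almost surely $$\big(\log(\varepsilon^{-1})\big)^{2-\delta}\preccurlyeq\Delta(\mathscr C_\lambda,\varepsilon).$$ -/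

import Mathlib

open scoped ENNReal NNReal Topology
open MeasureTheory ProbabilityTheory

/-- The finite subset of the line described by a list of fractions, the pair `(a, b)` standing
for the rational number `a / (b + 1)`. -/
def outputSet (l : List (ℤ × ℕ)) : Set ℝ :=
  {x : ℝ | ∃ r ∈ l, x = (r.1 : ℝ) / ((r.2 : ℝ) + 1)}

/-- A universal machine: a partial computable map `U` from binary programs to (descriptions of)
finite sets of points, such that every other such machine `V` can be simulated by `U` with
programs that are longer by at most an additive constant depending only on `V`. -/
def IsUniversalMachine (U : List Bool →. List (ℤ × ℕ)) : Prop :=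
  Partrec U ∧
    ∀ V : List Bool →. List (ℤ × ℕ), Partrec V →
      ∃ c : ℕ, ∀ (p : List Bool) (l : List (ℤ × ℕ)), l ∈ V p →
        ∃ q : List Bool, l ∈ U q ∧ q.length ≤ p.length + c

/-- The `ε`-distortion complexity of `K` relative to the machine `U`: the least length of a binary
program on which `U` halts with a finite set at Hausdorff distance less than `ε` from `K`.
The infimum in `ℕ∞` is a minimum as soon as there is such a program, and is `⊤` otherwise.
The extended Hausdorff distance is used, so that the empty output is never close to a nonempty
set. -/
noncomputable def distortionComplexity (U : List Bool →. List (ℤ × ℕ)) (K : Set ℝ) (ε : ℝ) : ℕ∞ :=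
  ⨅ (p : List Bool)
    (_ : ∃ l ∈ U p, Metric.hausdorffEDist (outputSet l) K < ENNReal.ofReal ε), (p.length : ℕ∞)

/-- `f ≼ g`: there is a positive constant `C` with `f ε ≤ C g ε` for all small enough `ε > 0`. -/
def AsympLE (f g : ℝ → ℝ≥0∞) : Prop :=
  ∃ C : ℝ≥0, 0 < C ∧ ∀ᶠ ε in 𝓝[>] (0 : ℝ), f ε ≤ (C : ℝ≥0∞) * g ε

/-- The endpoints of the `2 ^ k` intervals of step `k` of the construction, from left to right.
Each interval of step `k` has its central open subinterval of relative length `1 - lam k` removed,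
leaving two closed intervals of relative length `lam k / 2`. The ratio used for passing from step
`k` to step `k + 1` is `lam k`, that is, the sequence of ratios is indexed from `0`. -/
noncomputable def centralCantorIntervals (lam : ℕ → ℝ) : ℕ → List (ℝ × ℝ)
  | 0 => [(0, 1)]
  | k + 1 => (centralCantorIntervals lam k).flatMap fun I =>
      [(I.1, I.1 + lam k / 2 * (I.2 - I.1)), (I.2 - lam k / 2 * (I.2 - I.1), I.2)]

/-- The union of the intervals of step `k`. -/
def centralCantorStep (lam : ℕ → ℝ) (k : ℕ) : Set ℝ :=
  ⋃ I ∈ centralCantorIntervals lam k, Set.Icc I.1 I.2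

/-- The central Cantor set with ratios `lam`. -/
def centralCantorSet (lam : ℕ → ℝ) : Set ℝ :=
  ⋂ k : ℕ, centralCantorStep lam k

/-! Write `ℓ k` for the length of the intervals of step `k`. Upper bound: the left endpoints of step
`n` are the subset sums of the `n` shifts `ℓ i - ℓ (i + 1)`, and they are `2 ^ (-n)`-dense in the
Cantor set. Rounding each shift to `n` bits gives a program of `n ^ 2` bits with error at most `(n +
1) / 2 ^ n` (`exists_program_near`), and `n` of order `log ε⁻¹` suffices. Lower bound: the ratios
depend stably on the set. Two central Cantor sets at distance `e` have lengths differing by at most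
`2 ^ k * e` (`abs_cantorLength_sub_le`), hence ratios differing by at most `5 * 2 ^ k * e / ℓ k`
(`abs_ratio_sub_le`). By the law of large numbers `ℓ K ≥ τ ^ K` eventually. At precision `ρ ^ K`, a
given output therefore confines each of the first `K` ratios to an interval of length of order `(2 *
ρ / τ) ^ K`. By independence and the bounded density this has probability exponentially small in `K
^ 2`. For small `ρ` it beats the number of programs of length at most `K ^ 2`, and Borel–Cantelli
concludes. -/

/-- The common length of the intervals of step `k`. -/
noncomputable def cantorLength (lam : ℕ → ℝ) (k : ℕ) : ℝ := ∏ j ∈ Finset.range k, lam j / 2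

/-- The left endpoints of the intervals of step `k`. -/
noncomputable def cantorLeft (lam : ℕ → ℝ) : ℕ → Set ℝ
  | 0 => {0}
  | k + 1 => {x | ∃ s ∈ cantorLeft lam k,
      x = s ∨ x = s + (cantorLength lam k - cantorLength lam (k + 1))}

/-! ### Geometry of central Cantor sets and stability of their ratios -/

section Geometry

variable {lam : ℕ → ℝ}

theorem cantorLength_zero : cantorLength lam 0 = 1 := by simp [cantorLength]

theorem cantorLength_succ (k : ℕ) :
    cantorLength lam (k + 1) = cantorLength lam k * (lam k / 2) :=
  Finset.prod_range_succ _ _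

theorem mem_centralCantorIntervals (k : ℕ) (I : ℝ × ℝ) :
    I ∈ centralCantorIntervals lam k ↔
      ∃ s ∈ cantorLeft lam k, I = (s, s + cantorLength lam k) := by
  induction k generalizing I with
  | zero => simp [centralCantorIntervals, cantorLeft, cantorLength_zero]
  | succ k ih =>
    simp only [centralCantorIntervals, List.mem_flatMap, cantorLeft, Set.mem_ofPred_eq, ih]
    constructor
    · rintro ⟨_, ⟨s, hs, rfl⟩, h⟩
      simp only [List.mem_cons, List.not_mem_nil, or_false] at h
      rcases h with rfl | rfl
      · refine ⟨s, ⟨s, hs, Or.inl rfl⟩, ?_⟩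
        ext <;> simp [cantorLength_succ]
        all_goals ring
      · refine ⟨_, ⟨s, hs, Or.inr rfl⟩, ?_⟩
        ext <;> simp [cantorLength_succ]
        all_goals ring
    · rintro ⟨x, ⟨s, hs, rfl | rfl⟩, rfl⟩
      · refine ⟨_, ⟨x, hs, rfl⟩, ?_⟩
        simp only [List.mem_cons, Prod.mk.injEq]
        left
        constructor <;> simp [cantorLength_succ]
        all_goals ring
      · refine ⟨_, ⟨s, hs, rfl⟩, ?_⟩
        simp only [List.mem_cons, Prod.mk.injEq]
        right; left
        constructor <;> simp [cantorLength_succ]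
        all_goals ring

theorem mem_centralCantorStep (k : ℕ) (x : ℝ) :
    x ∈ centralCantorStep lam k ↔
      ∃ s ∈ cantorLeft lam k, s ≤ x ∧ x ≤ s + cantorLength lam k := by
  simp only [centralCantorStep, Set.mem_iUnion, mem_centralCantorIntervals, Set.mem_Icc]
  constructor
  · rintro ⟨_, ⟨s, hs, rfl⟩, h⟩
    exact ⟨s, hs, h⟩
  · rintro ⟨s, hs, h⟩
    exact ⟨_, ⟨s, hs, rfl⟩, h⟩

theorem mem_centralCantorSet (x : ℝ) :
    x ∈ centralCantorSet lam ↔ ∀ k, x ∈ centralCantorStep lam k := by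
  simp [centralCantorSet]

variable (hlam : ∀ k, lam k ∈ Set.Ioo (0 : ℝ) 1)
include hlam

theorem cantorLength_pos (k : ℕ) : 0 < cantorLength lam k :=
  Finset.prod_pos fun j _ => half_pos (hlam j).1

theorem two_mul_cantorLength_succ_le (k : ℕ) :
    2 * cantorLength lam (k + 1) ≤ cantorLength lam k := by
  rw [cantorLength_succ]
  nlinarith [cantorLength_pos hlam k, (hlam k).2]

theorem cantorLength_le (k : ℕ) : cantorLength lam k ≤ (1 / 2) ^ k := by
  induction k with
  | zero => simp [cantorLength_zero]
  | succ k ih =>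
    rw [pow_succ]
    linarith [two_mul_cantorLength_succ_le hlam k]

theorem centralCantorStep_antitone : Antitone (centralCantorStep lam) := by
  refine antitone_nat_of_succ_le fun k x hx => ?_
  have := two_mul_cantorLength_succ_le hlam k
  have := cantorLength_pos hlam (k + 1)
  obtain ⟨_, ⟨s, hs, rfl | rfl⟩, h1, h2⟩ := (mem_centralCantorStep _ _).1 hx
  · exact (mem_centralCantorStep _ _).2 ⟨_, hs, h1, by linarith⟩
  · exact (mem_centralCantorStep _ _).2 ⟨_, hs, by linarith, by linarith⟩

theorem mem_centralCantorSet_of_ge {x : ℝ} (k : ℕ)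
    (h : ∀ m, k ≤ m → x ∈ centralCantorStep lam m) : x ∈ centralCantorSet lam :=
  (mem_centralCantorSet x).2 fun m =>
    centralCantorStep_antitone hlam (le_max_left m k) (h _ (le_max_right m k))

theorem mem_centralCantorSet_of_mem_cantorLeft {x : ℝ} {k : ℕ} (hx : x ∈ cantorLeft lam k) :
    x ∈ centralCantorSet lam := by
  have key : ∀ m, k ≤ m → x ∈ cantorLeft lam m := by
    intro m hm
    induction m, hm using Nat.le_induction with
    | base => exact hx
    | succ m _ ih => exact ⟨x, ih, Or.inl rfl⟩
  refine mem_centralCantorSet_of_ge hlam k fun m hm => ?_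
  exact (mem_centralCantorStep _ _).2 ⟨x, key m hm, le_rfl, by linarith [cantorLength_pos hlam m]⟩

omit hlam in
theorem zero_mem_cantorLeft (k : ℕ) : (0 : ℝ) ∈ cantorLeft lam k := by
  induction k with
  | zero => simp [cantorLeft]
  | succ k ih => exact ⟨0, ih, Or.inl rfl⟩

theorem cantorLength_mem_centralCantorSet (k : ℕ) :
    cantorLength lam k ∈ centralCantorSet lam := by
  -- Always taking the right child, starting from the leftmost interval of step `k`, keeps the right
  -- endpoint fixed.
  have key : ∀ m, k ≤ m → cantorLength lam k - cantorLength lam m ∈ cantorLeft lam m := by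
    intro m hm
    induction m, hm using Nat.le_induction with
    | base => simpa using zero_mem_cantorLeft k
    | succ m _ ih => exact ⟨_, ih, Or.inr (by ring)⟩
  refine mem_centralCantorSet_of_ge hlam k fun m hm => ?_
  exact (mem_centralCantorStep _ _).2
    ⟨_, key m hm, by linarith [cantorLength_pos hlam m], by linarith⟩

/-- Isolates the leftmost interval from all others, so that its central gap is also a gap of the
whole set. -/
theorem eq_zero_or_le_of_mem_cantorLeft (k : ℕ) {s : ℝ} (hs : s ∈ cantorLeft lam k) :
    s = 0 ∨ cantorLength lam k ≤ s := by
  induction k generalizing s with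
  | zero => exact Or.inl (by simpa [cantorLeft] using hs)
  | succ k ih =>
    have := two_mul_cantorLength_succ_le hlam k
    have := cantorLength_pos hlam (k + 1)
    obtain ⟨s, hs, rfl | rfl⟩ := hs <;> rcases ih hs with h | h
    · exact Or.inl h
    · exact Or.inr (by linarith)
    · exact Or.inr (by linarith)
    · exact Or.inr (by linarith)

/-- The interval `[0, ℓ_k]` of step `k` has its central gap between `ℓ_{k+1}` and
`ℓ_k - ℓ_{k+1}`. -/
theorem le_cantorLength_succ_or_ge (k : ℕ) {x : ℝ} (hx : x ∈ centralCantorSet lam) :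
    x ≤ cantorLength lam (k + 1) ∨ cantorLength lam k - cantorLength lam (k + 1) ≤ x := by
  have := two_mul_cantorLength_succ_le hlam k
  have := cantorLength_pos hlam (k + 1)
  obtain ⟨_, ⟨s, hs, rfl | rfl⟩, h1, h2⟩ :=
    (mem_centralCantorStep _ _).1 ((mem_centralCantorSet x).1 hx (k + 1)) <;>
    rcases eq_zero_or_le_of_mem_cantorLeft hlam k hs with h | h
  · exact Or.inl (by linarith)
  · exact Or.inr (by linarith)
  · exact Or.inr (by linarith)
  · exact Or.inr (by linarith)

omit hlam in
theorem le_one_of_mem_centralCantorSet {x : ℝ} (hx : x ∈ centralCantorSet lam) : x ≤ 1 := by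
  obtain ⟨s, hs, h1, h2⟩ := (mem_centralCantorStep _ _).1 ((mem_centralCantorSet x).1 hx 0)
  simp only [cantorLeft, Set.mem_singleton_iff] at hs
  rw [cantorLength_zero] at h2
  linarith

/-- One step of the folding argument: closeness of the leftmost parts of step `k` passes to those
of step `k + 1`, with twice the error. -/
theorem exists_near_succ {lam' : ℕ → ℝ} (hlam' : ∀ k, lam' k ∈ Set.Ioo (0 : ℝ) 1) {k : ℕ} {e : ℝ}
    (he : |cantorLength lam k - cantorLength lam' k| ≤ e)
    (H : ∀ x ∈ centralCantorSet lam, x ≤ cantorLength lam k →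
      ∃ y ∈ centralCantorSet lam', y ≤ cantorLength lam' k ∧ |x - y| ≤ e)
    {x : ℝ} (hx : x ∈ centralCantorSet lam) (hxk : x ≤ cantorLength lam (k + 1)) :
    ∃ y ∈ centralCantorSet lam', y ≤ cantorLength lam' (k + 1) ∧ |x - y| ≤ 2 * e := by
  have h1 := two_mul_cantorLength_succ_le hlam k
  have h2 := cantorLength_pos hlam (k + 1)
  have h3 := two_mul_cantorLength_succ_le hlam' k
  have h4 := cantorLength_pos hlam' (k + 1)
  have he0 : 0 ≤ e := (abs_nonneg _).trans he
  obtain ⟨y, hy, hyk, hxy⟩ := H x hx (by linarith)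
  -- A `y` beyond the central gap is replaced by `ℓ' (k + 1)`, the right end of the left child. As
  -- `x` lies in the left half of `[0, ℓ k]` and `y` in the right half of `[0, ℓ' k]`, both are near
  -- the middle, which leaves an error of at most `2 * e`.
  rcases le_cantorLength_succ_or_ge hlam' k hy with h | h
  · exact ⟨y, hy, h, by linarith⟩
  · refine ⟨_, cantorLength_mem_centralCantorSet hlam' (k + 1), le_rfl, ?_⟩
    rw [abs_le] at he hxy ⊢
    constructor <;> linarith

/-- The induction carries the closeness of the parts in `[0, ℓ k]` and `[0, ℓ' k]`, doubling the
error at each step. Their maxima are `ℓ k` and `ℓ' k`, and close sets have close maxima (`top`). -/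
theorem abs_cantorLength_sub_le {lam' : ℕ → ℝ} (hlam' : ∀ k, lam' k ∈ Set.Ioo (0 : ℝ) 1) {e : ℝ}
    (H : ∀ x ∈ centralCantorSet lam, ∃ y ∈ centralCantorSet lam', |x - y| ≤ e)
    (H' : ∀ x ∈ centralCantorSet lam', ∃ y ∈ centralCantorSet lam, |x - y| ≤ e) (k : ℕ) :
    |cantorLength lam k - cantorLength lam' k| ≤ 2 ^ k * e := by
  have top : ∀ k, ∀ e : ℝ, (∀ x ∈ centralCantorSet lam, x ≤ cantorLength lam k →
      ∃ y ∈ centralCantorSet lam', y ≤ cantorLength lam' k ∧ |x - y| ≤ e) →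
      (∀ x ∈ centralCantorSet lam', x ≤ cantorLength lam' k →
      ∃ y ∈ centralCantorSet lam, y ≤ cantorLength lam k ∧ |x - y| ≤ e) →
      |cantorLength lam k - cantorLength lam' k| ≤ e := by
    intro k e h h'
    obtain ⟨y, -, hy, hy'⟩ := h _ (cantorLength_mem_centralCantorSet hlam k) le_rfl
    obtain ⟨z, -, hz, hz'⟩ := h' _ (cantorLength_mem_centralCantorSet hlam' k) le_rfl
    rw [abs_le] at hy' hz' ⊢
    constructor <;> linarith
  suffices h : (∀ x ∈ centralCantorSet lam, x ≤ cantorLength lam k →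
      ∃ y ∈ centralCantorSet lam', y ≤ cantorLength lam' k ∧ |x - y| ≤ 2 ^ k * e) ∧
      (∀ x ∈ centralCantorSet lam', x ≤ cantorLength lam' k →
      ∃ y ∈ centralCantorSet lam, y ≤ cantorLength lam k ∧ |x - y| ≤ 2 ^ k * e) from
    top k _ h.1 h.2
  induction k with
  | zero =>
    constructor
    · intro x hx _
      obtain ⟨y, hy, hxy⟩ := H x hx
      exact ⟨y, hy, by simpa [cantorLength_zero] using le_one_of_mem_centralCantorSet hy,
        by simpa using hxy⟩
    · intro x hx _
      obtain ⟨y, hy, hxy⟩ := H' x hx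
      exact ⟨y, hy, by simpa [cantorLength_zero] using le_one_of_mem_centralCantorSet hy,
        by simpa using hxy⟩
  | succ k ih =>
    have hk := top k _ ih.1 ih.2
    rw [pow_succ', mul_assoc]
    exact ⟨fun x hx hxk => exists_near_succ hlam hlam' hk ih.1 hx hxk,
      fun x hx hxk => exists_near_succ hlam' hlam (by rwa [abs_sub_comm]) ih.2 hx hxk⟩

/-- Two central Cantor sets that are close have close ratios, as long as their intervals are not
too short. -/
theorem abs_ratio_sub_le {lam' : ℕ → ℝ} (hlam' : ∀ k, lam' k ∈ Set.Ioo (0 : ℝ) 1) {e t : ℝ}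
    (H : ∀ x ∈ centralCantorSet lam, ∃ y ∈ centralCantorSet lam', |x - y| ≤ e)
    (H' : ∀ x ∈ centralCantorSet lam', ∃ y ∈ centralCantorSet lam, |x - y| ≤ e)
    (ht : 0 < t) {k : ℕ} (hk : t ≤ cantorLength lam k) :
    |lam k - lam' k| ≤ 5 * 2 ^ k * e / t := by
  have h0 := abs_cantorLength_sub_le hlam hlam' H H' k
  have h1 := abs_cantorLength_sub_le hlam hlam' H H' (k + 1)
  have hl := cantorLength_pos hlam k
  -- From `lam k * ℓ k = 2 * ℓ (k + 1)` for both sequences; the constant is `5 = 2 * 2 + 1`.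
  have hid : (lam k - lam' k) * cantorLength lam k =
      2 * (cantorLength lam (k + 1) - cantorLength lam' (k + 1)) -
        lam' k * (cantorLength lam k - cantorLength lam' k) := by
    rw [cantorLength_succ, cantorLength_succ]; ring
  have hb : |lam k - lam' k| * cantorLength lam k ≤ 5 * 2 ^ k * e := by
    rw [← abs_of_pos hl, ← abs_mul, hid]
    calc _ ≤ |2 * (cantorLength lam (k + 1) - cantorLength lam' (k + 1))| +
          |lam' k * (cantorLength lam k - cantorLength lam' k)| := abs_sub _ _
      _ ≤ 2 * (2 ^ (k + 1) * e) + 1 * (2 ^ k * e) := by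
          rw [abs_mul, abs_mul, abs_of_pos (hlam' k).1, abs_two]
          gcongr
          exact (hlam' k).2.le
      _ = _ := by ring
  rw [le_div_iff₀ ht]
  exact (mul_le_mul_of_nonneg_left hk (abs_nonneg _)).trans hb

end Geometry

/-! ### Upper bound: encoding by rounded subset sums -/

section Upper

/-- The number whose binary digits are the letters of a word. -/
def bitsValue (p : List Bool) : ℕ := p.foldl (fun a b => 2 * a + b.toNat) 0

/-- The list of the sums of subfamilies of the first `n` digits of `N` in base `B`. -/
def digitSums (B N n : ℕ) : List ℕ :=
  (List.range n).foldl (fun acc i => acc ++ acc.map (· + N / B ^ i % B)) [0]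

/-- The decoder of programs of length `n * n`, which are read as `n` numbers of `n` bits; it puts
out their subset sums, scaled by `2 ^ n`. -/
def subsetSumDecoder (p : List Bool) : List (ℤ × ℕ) :=
  (digitSums (2 ^ p.length.unpair.2) (bitsValue p) p.length.unpair.2).map
    fun s : ℕ => ((s : ℤ), 2 ^ p.length.unpair.2 - 1)

theorem primrec_pow : Primrec₂ ((· ^ ·) : ℕ → ℕ → ℕ) :=
  Primrec₂.unpaired'.1 Nat.Primrec.pow

theorem primrec_int_natCast : Primrec (fun n : ℕ => (n : ℤ)) := by
  -- The encoding of `ℤ` sends a natural number `n` to `2 * n`.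
  have h : Primrec fun n : ℕ => Encodable.encode (n : ℤ) :=
    (Primrec.nat_double).of_eq fun n => rfl
  exact Primrec.encode_iff.1 h

theorem primrec_bitsValue : Primrec bitsValue := by
  have hb : Primrec Bool.toNat := Primrec.encode.of_eq fun b => by cases b <;> rfl
  exact Primrec.list_foldl (h := fun _ (s : ℕ × Bool) => 2 * s.1 + s.2.toNat)
    Primrec.id (Primrec.const 0) (Primrec.nat_add.comp (Primrec.nat_double.comp (Primrec.fst.comp Primrec.snd))
    (hb.comp (Primrec.snd.comp Primrec.snd)))

theorem primrec_digitSums :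
    Primrec fun q : ℕ × ℕ × ℕ => digitSums q.1 q.2.1 q.2.2 := by
  refine Primrec.list_foldl (g := fun _ => [0])
    (h := fun (q : ℕ × ℕ × ℕ) (s : List ℕ × ℕ) => s.1 ++ s.1.map (· + q.2.1 / q.1 ^ s.2 % q.1))
    (Primrec.list_range.comp (Primrec.snd.comp Primrec.snd))
    (Primrec.const [0]) ?_
  refine Primrec.list_append.comp (Primrec.fst.comp Primrec.snd)
    (Primrec.list_map (Primrec.fst.comp Primrec.snd) ?_)
  refine Primrec.nat_add.comp Primrec.snd
    (Primrec.nat_mod.comp (Primrec.nat_div.comp ?_ (primrec_pow.comp ?_ ?_)) ?_)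
  · exact Primrec.fst.comp (Primrec.snd.comp (Primrec.fst.comp Primrec.fst))
  · exact Primrec.fst.comp (Primrec.fst.comp Primrec.fst)
  · exact Primrec.snd.comp (Primrec.snd.comp Primrec.fst)
  · exact Primrec.fst.comp (Primrec.fst.comp Primrec.fst)

theorem primrec_subsetSumDecoder : Primrec subsetSumDecoder := by
  have hn : Primrec fun p : List Bool => p.length.unpair.2 :=
    Primrec.snd.comp (Primrec.unpair.comp Primrec.list_length)
  have hB : Primrec fun p : List Bool => 2 ^ p.length.unpair.2 :=
    primrec_pow.comp (Primrec.const 2) hn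
  refine Primrec.list_map
    (primrec_digitSums.comp (hB.pair (primrec_bitsValue.pair hn))) ?_
  exact (primrec_int_natCast.comp Primrec.snd).pair
    (Primrec.nat_sub.comp (hB.comp Primrec.fst) (Primrec.const 1))

theorem exists_bitsValue_eq (m N : ℕ) (h : N < 2 ^ m) :
    ∃ p : List Bool, p.length = m ∧ bitsValue p = N := by
  induction m generalizing N with
  | zero => exact ⟨[], rfl, by simp at h; simp [bitsValue, h]⟩
  | succ m ih =>
    obtain ⟨p, hp, hN⟩ := ih (N / 2) (by rw [pow_succ] at h; omega)
    refine ⟨p ++ [decide (N % 2 = 1)], by simp [hp], ?_⟩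
    have : bitsValue (p ++ [decide (N % 2 = 1)]) =
      2 * bitsValue p + (decide (N % 2 = 1)).toNat := by simp [bitsValue]
    rw [this, hN]
    rcases Nat.mod_two_eq_zero_or_one N with h | h <;> simp [h] <;> omega

theorem exists_digits_eq (B n : ℕ) (j : ℕ → ℕ) (hj : ∀ i, j i < B) :
    ∃ N < B ^ n, ∀ i < n, N / B ^ i % B = j i := by
  induction n generalizing j with
  | zero => exact ⟨0, by simp, by simp⟩
  | succ n ih =>
    obtain ⟨N, hN, h⟩ := ih (fun i => j (i + 1)) fun i => hj _
    have hB : 0 < B := (Nat.zero_le _).trans_lt (hj 0)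
    refine ⟨j 0 + B * N, ?_, ?_⟩
    · have := hj 0
      calc j 0 + B * N < B * (N + 1) := by rw [mul_add]; omega
        _ ≤ B * B ^ n := Nat.mul_le_mul_left _ hN
        _ = B ^ (n + 1) := (pow_succ' _ _).symm
    · rintro (_ | i) hi
      · simp [Nat.mod_eq_of_lt (hj 0)]
      · rw [pow_succ', ← Nat.div_div_eq_div_mul, Nat.add_mul_div_left _ _ hB,
          Nat.div_eq_of_lt (hj 0), zero_add]
        exact h i (by omega)

theorem digitSums_succ (B N n : ℕ) :
    digitSums B N (n + 1) =
      digitSums B N n ++ (digitSums B N n).map (· + N / B ^ n % B) := by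
  simp [digitSums, List.range_succ]

/-- Subset sums of approximate steps approximate the left endpoints. -/
theorem cantorLeft_near_digitSums {lam : ℕ → ℝ} {B N n : ℕ} {e : ℝ} (he : 0 ≤ e)
    (h : ∀ i < n, |(cantorLength lam i - cantorLength lam (i + 1)) -
      ((N / B ^ i % B : ℕ) : ℝ) / B| ≤ e) :
    (∀ s ∈ cantorLeft lam n, ∃ m ∈ digitSums B N n, |s - (m : ℝ) / B| ≤ n * e) ∧
    (∀ m ∈ digitSums B N n, ∃ s ∈ cantorLeft lam n, |s - (m : ℝ) / B| ≤ n * e) := by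
  induction n with
  | zero => simp [cantorLeft, digitSums]
  | succ n ih =>
    obtain ⟨ih1, ih2⟩ := ih fun i hi => h i (by omega)
    have hn := h n (by omega)
    have key : ∀ (s d : ℝ) (m a : ℕ), |s - (m : ℝ) / B| ≤ n * e → |d - (a : ℝ) / B| ≤ e →
        |(s + d) - ((m + a : ℕ) : ℝ) / B| ≤ (n + 1 : ℕ) * e := by
      intro s d m a h1 h2
      have : (s + d) - ((m + a : ℕ) : ℝ) / B = (s - m / B) + (d - a / B) := by push_cast; ring
      rw [this]
      refine (abs_add_le _ _).trans ?_
      push_cast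
      linarith
    have key' : ∀ x : ℝ, x ≤ n * e → x ≤ (n + 1 : ℕ) * e := by
      intro x hx
      push_cast
      linarith
    rw [digitSums_succ]
    simp only [List.mem_append, List.mem_map, cantorLeft, Set.mem_ofPred_eq]
    constructor
    · rintro x ⟨s, hs, rfl | rfl⟩ <;> obtain ⟨m, hm, hsm⟩ := ih1 _ hs
      · exact ⟨m, Or.inl hm, key' _ hsm⟩
      · exact ⟨_, Or.inr ⟨m, hm, rfl⟩, key _ _ _ _ hsm hn⟩
    · rintro x (hx | ⟨m, hm, rfl⟩)
      · obtain ⟨s, hs, hsm⟩ := ih2 _ hx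
        exact ⟨s, ⟨s, hs, Or.inl rfl⟩, key' _ hsm⟩
      · obtain ⟨s, hs, hsm⟩ := ih2 _ hm
        exact ⟨_, ⟨s, hs, Or.inr rfl⟩, key _ _ _ _ hsm hn⟩

theorem mem_outputSet_subsetSumDecoder {p : List Bool} {n : ℕ} (hn : 0 < n)
    (hp : p.length = n * n) (x : ℝ) :
    x ∈ outputSet (subsetSumDecoder p) ↔
      ∃ m ∈ digitSums (2 ^ n) (bitsValue p) n, x = (m : ℝ) / (2 ^ n : ℕ) := by
  -- `Nat.pair 0 n = n * n` for positive `n`, so unpairing serves as a primitive recursive square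
  -- root, and the program need not spell out `n`.
  have hu : p.length.unpair.2 = n := by
    have : Nat.pair 0 n = n * n := by simp [Nat.pair, hn]
    rw [hp, ← this, Nat.unpair_pair]
  have h2 : ((2 ^ n - 1 : ℕ) : ℝ) + 1 = (2 ^ n : ℕ) := by
    rw [← Nat.cast_succ, Nat.succ_eq_add_one, Nat.sub_add_cancel Nat.one_le_two_pow]
  simp only [outputSet, subsetSumDecoder, hu, List.mem_map, Set.mem_ofPred_eq]
  constructor
  · rintro ⟨_, ⟨m, hm, rfl⟩, rfl⟩
    refine ⟨m, hm, ?_⟩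
    rw [h2, Int.cast_natCast]
  · rintro ⟨m, hm, rfl⟩
    refine ⟨_, ⟨m, hm, rfl⟩, ?_⟩
    rw [h2, Int.cast_natCast]

variable {lam : ℕ → ℝ}

/-- Some program of length `n * n` for the decoder describes the Cantor set with precision
`(n + 1) / 2 ^ n`. -/
theorem exists_program_near (hlam : ∀ k, lam k ∈ Set.Ioo (0 : ℝ) 1) {n : ℕ} (hn : 0 < n) :
    ∃ p : List Bool, p.length = n * n ∧
      Metric.hausdorffEDist (outputSet (subsetSumDecoder p)) (centralCantorSet lam) ≤
        ENNReal.ofReal ((n + 1) / 2 ^ n) := by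
  set d : ℕ → ℝ := fun i => cantorLength lam i - cantorLength lam (i + 1) with hd
  have hd0 : ∀ i, 0 ≤ d i := fun i => by
    have := two_mul_cantorLength_succ_le hlam i
    have := cantorLength_pos hlam (i + 1)
    simp only [hd]; linarith
  have hd1 : ∀ i, d i < 1 := fun i => by
    have := cantorLength_pos hlam (i + 1)
    have := (cantorLength_le hlam i).trans (pow_le_one₀ (by norm_num) (by norm_num))
    simp only [hd]; linarith
  have h2n : (0 : ℝ) < 2 ^ n := by positivity
  -- Each shift lies in `[0, 1)`, so its truncation to `n` bits is a digit in base `2 ^ n`.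
  obtain ⟨N, hN, hdig⟩ := exists_digits_eq (2 ^ n) n (fun i => ⌊d i * 2 ^ n⌋₊) fun i => by
    rw [Nat.floor_lt (by have := hd0 i; positivity)]
    push_cast
    have := hd1 i
    nlinarith
  obtain ⟨p, hp, hpN⟩ := exists_bitsValue_eq (n * n) N (by rwa [pow_mul])
  have he : (0 : ℝ) ≤ 1 / 2 ^ n := by positivity
  have happ : ∀ i < n, |(cantorLength lam i - cantorLength lam (i + 1)) -
      ((bitsValue p / (2 ^ n) ^ i % 2 ^ n : ℕ) : ℝ) / ((2 ^ n : ℕ) : ℝ)| ≤ 1 / 2 ^ n := by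
    intro i hi
    rw [hpN, hdig i hi]
    have h1 := Nat.floor_le (a := d i * 2 ^ n) (by have := hd0 i; positivity)
    have h2 := Nat.lt_floor_add_one (d i * 2 ^ n)
    push_cast
    have : d i - (⌊d i * 2 ^ n⌋₊ : ℝ) / 2 ^ n = (d i * 2 ^ n - ⌊d i * 2 ^ n⌋₊) / 2 ^ n := by
      field_simp
    rw [show cantorLength lam i - cantorLength lam (i + 1) = d i from rfl, this, abs_div,
      abs_of_pos h2n]
    gcongr
    rw [abs_le]
    constructor <;> linarith
  obtain ⟨hA, hB⟩ := cantorLeft_near_digitSums he happ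
  refine ⟨p, hp, Metric.hausdorffEDist_le_of_mem_edist ?_ ?_⟩
  · intro x hx
    obtain ⟨m, hm, rfl⟩ := (mem_outputSet_subsetSumDecoder hn hp x).1 hx
    obtain ⟨s, hs, hsm⟩ := hB m hm
    refine ⟨s, mem_centralCantorSet_of_mem_cantorLeft hlam hs, ?_⟩
    rw [edist_dist, dist_comm, Real.dist_eq]
    refine ENNReal.ofReal_le_ofReal (hsm.trans ?_)
    rw [mul_one_div]
    gcongr
    linarith
  · intro x hx
    obtain ⟨s, hs, h1, h2⟩ := (mem_centralCantorStep _ _).1 ((mem_centralCantorSet x).1 hx n)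
    obtain ⟨m, hm, hsm⟩ := hA s hs
    refine ⟨_, (mem_outputSet_subsetSumDecoder hn hp _).2 ⟨m, hm, rfl⟩, ?_⟩
    rw [edist_dist, Real.dist_eq]
    refine ENNReal.ofReal_le_ofReal ?_
    have hl := cantorLength_le hlam n
    rw [one_div, inv_pow, ← one_div] at hl
    -- One `2 ^ (-n)` for passing to the left endpoint, and `n` of them for the rounded shifts.
    calc _ ≤ |x - s| + |s - (m : ℝ) / ((2 ^ n : ℕ) : ℝ)| := abs_sub_le _ _ _
      _ ≤ 1 / 2 ^ n + n * (1 / 2 ^ n) := by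
        refine add_le_add ?_ hsm
        rw [abs_le]
        constructor <;> linarith
      _ = _ := by ring

theorem distortionComplexity_le {U : List Bool →. List (ℤ × ℕ)} {K : Set ℝ} {ε : ℝ}
    {p : List Bool} {l : List (ℤ × ℕ)} (hl : l ∈ U p)
    (h : Metric.hausdorffEDist (outputSet l) K < ENNReal.ofReal ε) :
    distortionComplexity U K ε ≤ p.length :=
  iInf₂_le p ⟨l, hl, h⟩

theorem asympLE_log_sq {U : List Bool →. List (ℤ × ℕ)} (hU : IsUniversalMachine U)
    (hlam : ∀ k, lam k ∈ Set.Ioo (0 : ℝ) 1) :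
    AsympLE (fun ε => (distortionComplexity U (centralCantorSet lam) ε : ℝ≥0∞))
      (fun ε => ENNReal.ofReal (Real.log ε⁻¹ ^ 2)) := by
  obtain ⟨c, hc⟩ := hU.2 (fun p => Part.some (subsetSumDecoder p))
    primrec_subsetSumDecoder.to_comp.partrec
  refine ⟨81 + c, by positivity, ?_⟩
  filter_upwards [Ioo_mem_nhdsGT (Real.exp_pos (-2))] with ε hε
  obtain ⟨hε0, hε1⟩ := hε
  set X := Real.log ε⁻¹ with hX
  have hεX : ε = Real.exp (-X) := by
    rw [hX, Real.log_inv, neg_neg, Real.exp_log hε0]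
  have hX2 : 2 < X := by
    rw [hεX, Real.exp_lt_exp] at hε1
    linarith
  -- With `n + 1 < exp (1 + n / 2)`, it suffices that `n * (log 2 - 1 / 2) ≥ 1 + X`, which `n ≥ 8 *
  -- X` and `X > 2` ensure. Moreover `n < 8 * X + 1 ≤ 9 * X`, whence the constant `81`.
  set n := ⌈8 * X⌉₊ with hn
  have hn1 : 8 * X ≤ n := Nat.le_ceil _
  have hn2 : (n : ℝ) < 8 * X + 1 := Nat.ceil_lt_add_one (by linarith)
  have hn0 : 0 < n := by
    have : (0 : ℝ) < n := by linarith
    exact_mod_cast this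
  obtain ⟨p, hp, hpd⟩ := exists_program_near hlam hn0
  have hlt : ((n : ℝ) + 1) / 2 ^ n < ε := by
    have h2 : (2 : ℝ) ^ n = Real.exp (n * Real.log 2) := by
      rw [mul_comm, Real.exp_mul, Real.exp_log (by norm_num), Real.rpow_natCast]
    have h1 : (n : ℝ) + 1 < Real.exp 1 * Real.exp (n / 2) := by
      have := Real.add_one_le_exp ((n : ℝ) / 2)
      have := Real.exp_one_gt_d9
      nlinarith
    rw [h2, div_lt_iff₀ (Real.exp_pos _)]
    refine h1.trans_le ?_
    rw [hεX, ← Real.exp_add, ← Real.exp_add, Real.exp_le_exp]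
    have := Real.log_two_gt_d9
    nlinarith
  obtain ⟨q, hq, hqp⟩ := hc p _ (Part.mem_some _)
  have hΔ := distortionComplexity_le hq
    (hpd.trans_lt ((ENNReal.ofReal_lt_ofReal_iff hε0).2 hlt))
  have hle : distortionComplexity U (centralCantorSet lam) ε ≤ ((n * n + c : ℕ) : ℕ∞) :=
    hΔ.trans (by rw [← hp]; exact_mod_cast hqp)
  have hreal : ((n * n + c : ℕ) : ℝ) ≤ (81 + c) * X ^ 2 := by
    push_cast
    have : (0 : ℝ) ≤ c := Nat.cast_nonneg c
    nlinarith [mul_nonneg this (by nlinarith : 0 ≤ X ^ 2 - 1)]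
  calc (distortionComplexity U (centralCantorSet lam) ε : ℝ≥0∞)
      ≤ (((n * n + c : ℕ) : ℕ∞) : ℝ≥0∞) := by exact_mod_cast hle
    _ = ENNReal.ofReal ((n * n + c : ℕ) : ℝ) := by
        rw [ENNReal.ofReal_natCast]; rfl
    _ ≤ ENNReal.ofReal ((81 + c) * X ^ 2) := ENNReal.ofReal_le_ofReal hreal
    _ = _ := by
        rw [ENNReal.ofReal_mul (by positivity)]
        congr 1
        rw [← ENNReal.ofReal_coe_nnreal]
        simp

end Upper

/-! ### Lower bound: counting programs and Borel–Cantelli -/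

section Lower

/-- There are fewer than `2 ^ (L + 1)` programs of length at most `L`. -/
theorem measure_distortionComplexity_le {Ω : Type*} [MeasurableSpace Ω] (P : Measure Ω)
    (U : List Bool →. List (ℤ × ℕ)) (C : Ω → Set ℝ) (G : Set Ω) (ε : ℝ) (L : ℕ) (x : ℝ≥0∞)
    (H : ∀ l, P {ω | ω ∈ G ∧ Metric.hausdorffEDist (outputSet l) (C ω) < ENNReal.ofReal ε} ≤ x) :
    P {ω | ω ∈ G ∧ distortionComplexity U (C ω) ε ≤ L} ≤ 2 ^ (L + 1) * x := by
  have Hp : ∀ p, P {ω | ω ∈ G ∧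
      ∃ l ∈ U p, Metric.hausdorffEDist (outputSet l) (C ω) < ENNReal.ofReal ε} ≤ x := by
    intro p
    by_cases hp : ∃ l, l ∈ U p
    · obtain ⟨l, hl⟩ := hp
      refine (measure_mono ?_).trans (H l)
      rintro ω ⟨hG, l', hl', h⟩
      exact ⟨hG, by rwa [Part.mem_unique hl hl']⟩
    · refine (measure_mono (t := ∅) ?_).trans (by simp)
      rintro ω ⟨hG, l', hl', h⟩
      exact hp ⟨l', hl'⟩
  have hsub : {ω | ω ∈ G ∧ distortionComplexity U (C ω) ε ≤ L} ⊆
      ⋃ j ∈ Finset.range (L + 1), ⋃ v ∈ (Finset.univ : Finset (List.Vector Bool j)),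
        {ω | ω ∈ G ∧ ∃ l ∈ U v.toList,
          Metric.hausdorffEDist (outputSet l) (C ω) < ENNReal.ofReal ε} := by
    rintro ω ⟨hG, h⟩
    have h' : distortionComplexity U (C ω) ε < ((L + 1 : ℕ) : ℕ∞) :=
      h.trans_lt (by exact_mod_cast L.lt_succ_self)
    simp only [distortionComplexity, iInf_lt_iff] at h'
    obtain ⟨p, hp, hpL⟩ := h'
    simp only [Set.mem_iUnion]
    exact ⟨p.length, Finset.mem_range.2 (by exact_mod_cast hpL), ⟨p, rfl⟩, Finset.mem_univ _,
      hG, hp⟩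
  calc _ ≤ _ := measure_mono hsub
    _ ≤ ∑ j ∈ Finset.range (L + 1), ∑ _v : List.Vector Bool j, x :=
        (measure_biUnion_finset_le _ _).trans <| Finset.sum_le_sum fun j _ =>
          (measure_biUnion_finset_le _ _).trans <| Finset.sum_le_sum fun v _ => Hp _
    _ = ((∑ j ∈ Finset.range (L + 1), 2 ^ j : ℕ) : ℝ≥0∞) * x := by
        simp [card_vector, Finset.sum_mul]
    _ ≤ 2 ^ (L + 1) * x := by
        gcongr
        have : ∑ j ∈ Finset.range (L + 1), 2 ^ j ≤ 2 ^ (L + 1) := by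
          rw [Nat.geomSum_eq le_rfl]; simp
        exact_mod_cast this

theorem map_le_of_density_le {Ω : Type*} [MeasurableSpace Ω] {P : Measure Ω} {X : Ω → ℝ}
    {f : ℝ → ℝ} {b : ℝ} (hf : ∀ x ∈ Set.Ioo (0 : ℝ) 1, f x ≤ b)
    (h : P.map X =
      (volume.restrict (Set.Ioo (0 : ℝ) 1)).withDensity (fun x => ENNReal.ofReal (f x))) :
    P.map X ≤ ENNReal.ofReal b • volume.restrict (Set.Ioo (0 : ℝ) 1) := by
  rw [h, ← withDensity_const]
  refine withDensity_mono ?_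
  filter_upwards [ae_restrict_mem measurableSet_Ioo] with x hx
  exact ENNReal.ofReal_le_ofReal (hf x hx)

/-- The logarithm is Lebesgue integrable near `0`, and a bounded density preserves this; it is the
moment condition for the law of large numbers. -/
theorem integrable_log_of_map_le {Ω : Type*} [MeasurableSpace Ω] {P : Measure Ω} {X : Ω → ℝ}
    (hX : Measurable X) {b : ℝ}
    (h : P.map X ≤ ENNReal.ofReal b • volume.restrict (Set.Ioo (0 : ℝ) 1)) :
    Integrable (fun ω => Real.log (X ω)) P := by
  have hlog : IntegrableOn Real.log (Set.Ioo 0 1) volume :=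
    ((intervalIntegrable_iff_integrableOn_Ioo_of_le zero_le_one).1
      intervalIntegral.intervalIntegrable_log')
  have := (hlog.smul_measure (c := ENNReal.ofReal b) ENNReal.ofReal_ne_top).mono_measure h
  exact (integrable_map_measure Real.measurable_log.aestronglyMeasurable hX.aemeasurable).1 this

variable {Ω : Type*} [MeasurableSpace Ω] {P : Measure Ω} {lam : ℕ → Ω → ℝ}

/-- By the law of large numbers, the lengths decay at most exponentially. -/
theorem exists_pow_le_cantorLength (hlam : ∀ k ω, lam k ω ∈ Set.Ioo (0 : ℝ) 1) (hind : iIndepFun lam P)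
    (hid : ∀ k, IdentDistrib (lam k) (lam 0) P P)
    (hint : Integrable (fun ω => Real.log (lam 0 ω)) P) :
    ∃ τ : ℝ, 0 < τ ∧ ∀ᵐ ω ∂P, ∀ᶠ K in Filter.atTop,
      τ ^ K ≤ cantorLength (fun k => lam k ω) K := by
  have hslln := strong_law_ae_real (fun k ω => Real.log (lam k ω)) hint
    (fun i j hij => (hind.indepFun hij).comp Real.measurable_log Real.measurable_log)
    (fun k => (hid k).comp Real.measurable_log)
  set E : ℝ := ∫ ω, Real.log (lam 0 ω) ∂P
  -- Any number below the mean `E` would do for `E - 1`; the `2` comes from the factors `lam j / 2`.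
  refine ⟨Real.exp (E - 1) / 2, by positivity, ?_⟩
  filter_upwards [hslln] with ω hω
  filter_upwards [hω.eventually (lt_mem_nhds (sub_one_lt E)), Filter.eventually_gt_atTop 0]
    with K hK hK0
  have hK0' : (0 : ℝ) < K := by exact_mod_cast hK0
  rw [lt_div_iff₀ hK0'] at hK
  have : cantorLength (fun k => lam k ω) K =
      Real.exp (∑ i ∈ Finset.range K, Real.log (lam i ω)) / 2 ^ K := by
    rw [Real.exp_sum, cantorLength, Finset.prod_div_distrib]
    simp only [Finset.prod_const, Finset.card_range]
    congr 1
    exact Finset.prod_congr rfl fun i _ => (Real.exp_log (hlam i ω).1).symm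
  rw [this, div_pow, ← Real.exp_nat_mul]
  gcongr
  linarith

/-- A fixed finite set is close to the random Cantor set with small probability. -/
theorem measure_hausdorffEDist_lt_le [IsProbabilityMeasure P] (hmeas : ∀ k, Measurable (lam k))
    (hlam : ∀ k ω, lam k ω ∈ Set.Ioo (0 : ℝ) 1) (hind : iIndepFun lam P)
    (hid : ∀ k, IdentDistrib (lam k) (lam 0) P P) {b : ℝ}
    (h : P.map (lam 0) ≤ ENNReal.ofReal b • volume.restrict (Set.Ioo (0 : ℝ) 1))
    {ε t : ℝ} (hε : 0 ≤ ε) (ht : 0 < t) (K : ℕ) (A : Set ℝ) :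
    P {ω | t ≤ cantorLength (fun k => lam k ω) K ∧
      Metric.hausdorffEDist A (centralCantorSet fun k => lam k ω) < ENNReal.ofReal ε} ≤
      (ENNReal.ofReal b * ENNReal.ofReal (20 * 2 ^ K * ε / t)) ^ K := by
  -- A sample `ω'` of the event serves as reference. Every other sample gives a set within `2 * ε`
  -- of its set, by the triangle inequality through `A`, so its ratios lie within `r` of those of
  -- `ω'`.
  rcases Set.eq_empty_or_nonempty {ω | t ≤ cantorLength (fun k => lam k ω) K ∧
      Metric.hausdorffEDist A (centralCantorSet fun k => lam k ω) < ENNReal.ofReal ε}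
    with hem | ⟨ω', hω', hA'⟩
  · rw [hem]; simp
  set r : ℝ := 10 * 2 ^ K * ε / t with hr
  have hsub : {ω | t ≤ cantorLength (fun k => lam k ω) K ∧
      Metric.hausdorffEDist A (centralCantorSet fun k => lam k ω) < ENNReal.ofReal ε} ⊆
      ⋂ k ∈ Finset.range K, lam k ⁻¹' Metric.closedBall (lam k ω') r := by
    rintro ω ⟨hω, hA⟩
    have near : ∀ ω₁ ω₂ : Ω,
        Metric.hausdorffEDist A (centralCantorSet fun k => lam k ω₁) < ENNReal.ofReal ε →
        Metric.hausdorffEDist A (centralCantorSet fun k => lam k ω₂) < ENNReal.ofReal ε →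
        ∀ x ∈ centralCantorSet (fun k => lam k ω₁),
          ∃ y ∈ centralCantorSet (fun k => lam k ω₂), |x - y| ≤ 2 * ε := by
      intro ω₁ ω₂ h1 h2 x hx
      rw [Metric.hausdorffEDist_comm] at h1
      obtain ⟨z, hz, hxz⟩ := Metric.exists_edist_lt_of_hausdorffEDist_lt hx h1
      obtain ⟨y, hy, hzy⟩ := Metric.exists_edist_lt_of_hausdorffEDist_lt hz h2
      refine ⟨y, hy, ?_⟩
      have := (edist_triangle x z y).trans (add_le_add hxz.le hzy.le)
      rw [← ENNReal.ofReal_add hε hε, edist_dist,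
        ENNReal.ofReal_le_ofReal_iff (by linarith), Real.dist_eq] at this
      linarith
    simp only [Set.mem_iInter, Finset.mem_range, Set.mem_preimage, Metric.mem_closedBall,
      Real.dist_eq]
    intro k hk
    have hlen : t ≤ cantorLength (fun k => lam k ω) k := by
      refine hω.trans (antitone_nat_of_succ_le (f := cantorLength fun k => lam k ω)
        (fun m => ?_) hk.le)
      have := two_mul_cantorLength_succ_le (fun k => hlam k ω) m
      have := cantorLength_pos (fun k => hlam k ω) (m + 1)
      linarith
    refine (abs_ratio_sub_le (fun k => hlam k ω) (fun k => hlam k ω') (near _ _ hA hA')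
      (near _ _ hA' hA) ht hlen).trans ?_
    have h2 : (2 : ℝ) ^ k ≤ 2 ^ K := pow_le_pow_right₀ one_le_two hk.le
    rw [hr]
    gcongr ?_ / t
    nlinarith
  calc _ ≤ _ := measure_mono hsub
    _ = ∏ k ∈ Finset.range K, P (lam k ⁻¹' Metric.closedBall (lam k ω') r) :=
        hind.measure_inter_preimage_eq_mul _ fun _ _ => measurableSet_closedBall
    _ ≤ ∏ _k ∈ Finset.range K, ENNReal.ofReal b * ENNReal.ofReal (20 * 2 ^ K * ε / t) := by
        refine Finset.prod_le_prod' fun k _ => ?_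
        rw [← Measure.map_apply (hmeas k) measurableSet_closedBall, (hid k).map_eq]
        refine (h _).trans ?_
        rw [Measure.smul_apply, smul_eq_mul]
        gcongr
        refine (Measure.restrict_apply_le _ _).trans ?_
        rw [Real.volume_closedBall]
        refine ENNReal.ofReal_le_ofReal (le_of_eq ?_)
        rw [hr]; ring
    _ = _ := by simp

/-- The bad events have summable probabilities, at most `2 * (1 / 2) ^ K`, so Borel–Cantelli
applies. -/
theorem exists_forall_sq_lt_distortionComplexity [IsProbabilityMeasure P]
    (U : List Bool →. List (ℤ × ℕ)) (hmeas : ∀ k, Measurable (lam k))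
    (hlam : ∀ k ω, lam k ω ∈ Set.Ioo (0 : ℝ) 1) (hind : iIndepFun lam P)
    (hid : ∀ k, IdentDistrib (lam k) (lam 0) P P) {b : ℝ} (hb : 0 ≤ b)
    (h : P.map (lam 0) ≤ ENNReal.ofReal b • volume.restrict (Set.Ioo (0 : ℝ) 1)) :
    ∃ ρ ∈ Set.Ioo (0 : ℝ) 1, ∀ᵐ ω ∂P, ∀ᶠ K : ℕ in Filter.atTop,
      ((K ^ 2 : ℕ) : ℕ∞) <
        distortionComplexity U (centralCantorSet fun k => lam k ω) (ρ ^ K) := by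
  obtain ⟨τ, hτ, hgood⟩ := exists_pow_le_cantorLength hlam hind hid
    (integrable_log_of_map_le (hmeas 0) h)
  set D : ℝ := 20 * b + 1 with hD
  have hD0 : 0 < D := by positivity
  -- The `2 ^ (K ^ 2)` programs turn `2 * ρ / τ` into `4 * ρ / τ`; this `ρ` makes `D * (4 * ρ / τ) ≤
  -- 1 / 2`, where `D ≥ 1` absorbs the factor `20 * b` into `D ^ K`.
  set ρ : ℝ := min (1 / 2) (τ / (8 * D)) with hρ
  have hρ0 : 0 < ρ := by positivity
  have hρτ : D * (4 * ρ / τ) ≤ 1 / 2 := by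
    have : ρ ≤ τ / (8 * D) := min_le_right _ _
    rw [le_div_iff₀ (by positivity)] at this
    rw [← mul_div_assoc, div_le_iff₀ hτ]
    linarith
  refine ⟨ρ, ⟨hρ0, (min_le_left _ _).trans_lt (by norm_num)⟩, ?_⟩
  set bad : ℕ → Set Ω := fun K => {ω | ω ∈ {ω | τ ^ K ≤ cantorLength (fun k => lam k ω) K} ∧
    distortionComplexity U (centralCantorSet fun k => lam k ω) (ρ ^ K) ≤ ((K ^ 2 : ℕ) : ℕ∞)}
  have hbound : ∀ K, P (bad K) ≤ ENNReal.ofReal (2 * (1 / 2) ^ K) := by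
    intro K
    refine (measure_distortionComplexity_le P U (fun ω => centralCantorSet fun k => lam k ω) _
      (ρ ^ K) (K ^ 2) _ fun l => measure_hausdorffEDist_lt_le hmeas hlam hind hid h
        (pow_nonneg hρ0.le K) (pow_pos hτ K) K (outputSet l)).trans ?_
    rw [← ENNReal.ofReal_mul hb, ← ENNReal.ofReal_pow (by positivity),
      show (2 : ℝ≥0∞) = ENNReal.ofReal 2 by simp, ← ENNReal.ofReal_pow (by positivity),
      ← ENNReal.ofReal_mul (by positivity)]
    refine ENNReal.ofReal_le_ofReal ?_
    rcases Nat.eq_zero_or_pos K with rfl | hK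
    · simp
    have e1 : (2 : ℝ) ^ (K ^ 2 + 1) * (b * (20 * 2 ^ K * ρ ^ K / τ ^ K)) ^ K =
        2 * (20 * b * (4 * ρ / τ) ^ K) ^ K := by
      have : (4 : ℝ) ^ K = 2 ^ K * 2 ^ K := by rw [← mul_pow]; norm_num
      rw [pow_succ, sq, pow_mul, div_pow, mul_pow 4, this, mul_comm _ (2 : ℝ), mul_assoc,
        ← mul_pow]
      ring
    have hx : 0 ≤ 4 * ρ / τ := by positivity
    have e2 : 20 * b * (4 * ρ / τ) ^ K ≤ 1 / 2 := by
      calc 20 * b * (4 * ρ / τ) ^ K ≤ D ^ K * (4 * ρ / τ) ^ K := by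
            gcongr
            exact (by linarith : 20 * b ≤ D).trans
              (le_self_pow₀ (by linarith) hK.ne')
        _ = (D * (4 * ρ / τ)) ^ K := (mul_pow _ _ _).symm
        _ ≤ (1 / 2) ^ K := by gcongr
        _ ≤ 1 / 2 := pow_le_of_le_one (by norm_num) (by norm_num) hK.ne'
    rw [e1]
    gcongr
  have hsum : ∑' K, P (bad K) ≠ ∞ := by
    refine ne_top_of_le_ne_top ?_ (ENNReal.tsum_le_tsum hbound)
    exact (Summable.mul_left 2 summable_geometric_two).tsum_ofReal_ne_top
  filter_upwards [hgood, ae_eventually_notMem hsum] with ω h1 h2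
  filter_upwards [h1, h2] with K h3 h4
  by_contra hcon
  exact h4 ⟨h3, not_lt.1 hcon⟩

theorem distortionComplexity_antitone (U : List Bool →. List (ℤ × ℕ)) (K : Set ℝ) :
    Antitone (distortionComplexity U K) := by
  intro ε ε' h
  refine iInf_mono fun p => le_iInf fun ⟨l, hl, hd⟩ => ?_
  exact iInf_le_of_le ⟨l, hl, hd.trans_le (ENNReal.ofReal_le_ofReal h)⟩ le_rfl

/-- A quadratic lower bound along a geometric sequence of precisions gives one for all of them. -/
theorem asympLE_of_eventually_sq_lt (U : List Bool →. List (ℤ × ℕ)) (C : Set ℝ) {ρ : ℝ}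
    (hρ : ρ ∈ Set.Ioo (0 : ℝ) 1)
    (h : ∀ᶠ K : ℕ in Filter.atTop, ((K ^ 2 : ℕ) : ℕ∞) < distortionComplexity U C (ρ ^ K))
    {δ : ℝ} (hδ : 0 ≤ δ) :
    AsympLE (fun ε => ENNReal.ofReal (Real.log ε⁻¹ ^ (2 - δ)))
      (fun ε => (distortionComplexity U C ε : ℝ≥0∞)) := by
  set M : ℝ := Real.log ρ⁻¹ with hM
  have hM0 : 0 < M := Real.log_pos (one_lt_inv_iff₀.2 hρ)
  obtain ⟨K₀, hK₀⟩ := Filter.eventually_atTop.1 h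
  refine ⟨(4 * M ^ 2).toNNReal, Real.toNNReal_pos.2 (by positivity), ?_⟩
  -- The threshold yields both `X ≥ 1`, so that `X ^ (2 - δ) ≤ X ^ 2`, and `K ≥ K₀ + 1` for the `K`
  -- below.
  filter_upwards [Ioo_mem_nhdsGT (Real.exp_pos (-(1 + (K₀ + 1) * M)))] with ε hε
  obtain ⟨hε0, hε1⟩ := hε
  set X := Real.log ε⁻¹ with hX
  have hεX : ε = Real.exp (-X) := by
    rw [hX, Real.log_inv, neg_neg, Real.exp_log hε0]
  have hρM : ρ = Real.exp (-M) := by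
    rw [hM, Real.log_inv, neg_neg, Real.exp_log hρ.1]
  have hXl : 1 + (K₀ + 1) * M < X := by
    rw [hεX, Real.exp_lt_exp] at hε1
    linarith
  have hX1 : 1 ≤ X := by nlinarith [(Nat.cast_nonneg K₀ : (0 : ℝ) ≤ K₀)]
  -- The largest `K` with `ε ≤ ρ ^ K`; then `X < (K + 1) * M ≤ 2 * K * M`.
  set K := ⌊X / M⌋₊ with hK
  have hK1 : K * M ≤ X := (le_div_iff₀ hM0).1 (Nat.floor_le (by positivity))
  have hK2 : X < (K + 1) * M := (div_lt_iff₀ hM0).1 (Nat.lt_floor_add_one _)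
  have hKK : K₀ + 1 ≤ K := by
    refine Nat.le_floor ?_
    rw [le_div_iff₀ hM0]
    push_cast
    linarith
  have hle : ((K ^ 2 : ℕ) : ℕ∞) ≤ distortionComplexity U C ε := by
    refine (hK₀ K (by omega)).le.trans (distortionComplexity_antitone U C ?_)
    rw [hρM, hεX, ← Real.exp_nat_mul, Real.exp_le_exp]
    linarith
  have hreal : X ^ (2 - δ) ≤ 4 * M ^ 2 * ((K ^ 2 : ℕ) : ℝ) := by
    have hK1' : (1 : ℝ) ≤ K := by exact_mod_cast (by omega : 1 ≤ K)
    calc X ^ (2 - δ) ≤ X ^ (2 : ℝ) := Real.rpow_le_rpow_of_exponent_le hX1 (by linarith)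
      _ = X ^ 2 := by norm_cast
      _ ≤ (2 * K * M) ^ 2 := by
          gcongr
          nlinarith
      _ = _ := by push_cast; ring
  calc ENNReal.ofReal (X ^ (2 - δ)) ≤ ENNReal.ofReal (4 * M ^ 2 * ((K ^ 2 : ℕ) : ℝ)) :=
        ENNReal.ofReal_le_ofReal hreal
    _ = ENNReal.ofReal (4 * M ^ 2) * (((K ^ 2 : ℕ) : ℕ∞) : ℝ≥0∞) := by
        rw [ENNReal.ofReal_mul (by positivity), ENNReal.ofReal_natCast]; rfl
    _ ≤ _ := by
        rw [ENNReal.ofReal]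
        gcongr

end Lower

theorem theorem3 (U : List Bool →. List (ℤ × ℕ)) (hU : IsUniversalMachine U) :
    (∀ lam : ℕ → ℝ, (∀ k, lam k ∈ Set.Ioo (0 : ℝ) 1) →
      AsympLE (fun ε => (distortionComplexity U (centralCantorSet lam) ε : ℝ≥0∞))
        (fun ε => ENNReal.ofReal (Real.log ε⁻¹ ^ 2))) ∧
    (∀ (Ω : Type*) [MeasurableSpace Ω] (P : Measure Ω) [IsProbabilityMeasure P]
      (lam : ℕ → Ω → ℝ) (f : ℝ → ℝ) (a b : ℝ),
      (∀ k, Measurable (lam k)) →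
      (∀ k ω, lam k ω ∈ Set.Ioo (0 : ℝ) 1) →
      iIndepFun lam P →
      (∀ k, IdentDistrib (lam k) (lam 0) P P) →
      Measurable f →
      0 < a →
      (∀ x ∈ Set.Ioo (0 : ℝ) 1, a ≤ f x ∧ f x ≤ b) →
      P.map (lam 0) =
        (volume.restrict (Set.Ioo (0 : ℝ) 1)).withDensity (fun x => ENNReal.ofReal (f x)) →
      ∀ δ : ℝ, 0 < δ →
        ∀ᵐ ω ∂P,
          AsympLE (fun ε => ENNReal.ofReal (Real.log ε⁻¹ ^ (2 - δ)))
            (fun ε =>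
              (distortionComplexity U (centralCantorSet fun k => lam k ω) ε : ℝ≥0∞))) := by
  refine ⟨fun lam hlam => asympLE_log_sq hU hlam, ?_⟩
  intro Ω _ P _ lam f a b hmeas hlam hind hid _ ha hf hmap δ hδ
  have hb : 0 ≤ b := by
    obtain ⟨h1, h2⟩ := hf (1 / 2) (by constructor <;> norm_num)
    linarith
  obtain ⟨ρ, hρ, h⟩ := exists_forall_sq_lt_distortionComplexity U hmeas hlam hind hid hb
    (map_le_of_density_le (fun x hx => (hf x hx).2) hmap)
  filter_upwards [h] with ω hω
  exact asympLE_of_eventually_sq_lt U _ hρ hω hδ.le
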